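/- Let $k\ge 2$, $\lambda>0$ and $\mu_1,\dots,\mu_k>0$. Consider $k$ parallel single-server queues with infinite waiting rooms. Customers arrive according to a Poisson process with rate $\lambda$ and join a shortest queue, ties being broken uniformly at random, and service times at queue $i$ are independent and exponentially distributed with rate $\mu_i$. Let $\boldsymbol L_\ell=(L_{\ell 1},\dots,L_{\ell k})$, $\ell=0,1,2,\dots$, be the vector of queue lengths (including customers in service) uniformized at rate $\Lambda=\lambda+\sum_{i=1}^k\mu_i$. That is, $(\boldsymbol L_\ell)$ is the discrete time Markov chain on $\mathbb Z_+^k$ which, from a state $\boldsymbol x$, moves to $\boldsymbol x+\boldsymbol e_i$ with probability $\lambda/(\Lambda\,|U|)$ for each $i\in U=\{j: x_j=\min_m x_m\}$, moves to $\boldsymbol x-\boldsymbol e_i$ with probability $\mu_i/\Lambda$ for each $i$ with $x_i\ge 1$, and otherwise stays at $\boldsymbol x$, where $\boldsymbol e_i$ is the $i$-th unit vector. Let $\rho=\lambda/\sum_{i=1}^k\mu_i$ and assume that $\rho<1$. Then the chain has a unique stationary distribution. If $\boldsymbol L=(L_1,\dots,L_k)$ is distributed according to it and $M=\min_{1\le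 i\le k}L_i$, then $$\lim_{n\to\infty}\frac1n\log\mathbb P(M=n)=\log\rho^k .$$ -/

import Mathlib

open MeasureTheory ProbabilityTheory Filter Topology
open scoped ENNReal

namespace JSQ

/-- The length of the shortest queue: the minimum of the queue lengths `x 0, …, x (k - 1)`
(a minimum over a nonempty index set as soon as `k ≥ 1`). -/
noncomputable def minQueue {k : ℕ} (x : Fin k → ℕ) : ℕ := ⨅ i, x i

/-- The set of (indices of) shortest queues in state `x`. -/
noncomputable def shortest {k : ℕ} (x : Fin k → ℕ) : Finset (Fin k) :=
  {i | x i = minQueue x}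

/-- The state after one customer has joined queue `i`. -/
def arrive {k : ℕ} (x : Fin k → ℕ) (i : Fin k) : Fin k → ℕ := Function.update x i (x i + 1)

/-- The state after a service completion at queue `i`. The subtraction is truncated: a (virtual)
service completion at an empty queue leaves the state unchanged. -/
def depart {k : ℕ} (x : Fin k → ℕ) (i : Fin k) : Fin k → ℕ := Function.update x i (x i - 1)

/-- Traffic intensity `ρ = λ / ∑ i, μ i`. -/
noncomputable def trafficIntensity {k : ℕ} (lam : ℝ) (mu : Fin k → ℝ) : ℝ := lam / ∑ i, mu i

/-- Uniformization constant `λ + ∑ i, μ i`; it is `1` after the usual choice of time unit. -/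
noncomputable def totalRate {k : ℕ} (lam : ℝ) (mu : Fin k → ℝ) : ℝ := lam + ∑ i, mu i

/-- The one-step law from state `x` of the queue length vector of the join-the-shortest-queue
system, uniformized at rate `totalRate lam mu`:
* with probability `λ / totalRate` a customer arrives and joins one of the shortest queues,
  all of these being equally likely;
* with probability `μ i / totalRate` there is a (possibly virtual) service completion
  at queue `i`. -/
noncomputable def stepLaw {k : ℕ} (lam : ℝ) (mu : Fin k → ℝ) (x : Fin k → ℕ) :
    Measure (Fin k → ℕ) :=
  (∑ i ∈ shortest x,
      ENNReal.ofReal (lam / totalRate lam mu / (shortest x).card) • Measure.dirac (arrive x i))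
    + ∑ i, ENNReal.ofReal (mu i / totalRate lam mu) • Measure.dirac (depart x i)

/-- The transition kernel of the uniformized queue length chain. -/
noncomputable def chain {k : ℕ} (lam : ℝ) (mu : Fin k → ℝ) :
    Kernel (Fin k → ℕ) (Fin k → ℕ) :=
  Kernel.ofFunOfCountable (stepLaw lam mu)

/-- `π` is a stationary distribution of the queue length chain. -/
def IsStationary {k : ℕ} (lam : ℝ) (mu : Fin k → ℝ) (π : Measure (Fin k → ℕ)) : Prop :=
  IsProbabilityMeasure π ∧ (chain lam mu).Invariant π

end JSQ

namespace JSQ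

/-! Let `s n` be the stationary probability of `n` customers in total. Balancing the flow between
`n` and `n + 1` customers gives `s (n + 1) ≥ ρ * s n`, and equality can fail only through states
with an idle server. Hence `s n ≥ ρ ^ n * π {0}`.

For the matching upper bound, joining the shortest queue is used twice. The longest queue passes
level `m` only by an arrival in the balanced state `(m, …, m)`, and above that level a quadratic
Lyapunov function drifts down, so `P(max > m) ≤ C * P(L = (m, …, m)) ≤ C * s (k * m)` for large `m`
(`exists_longer_le`). If a server idles while `n + 1` customers are present, some queue exceeds
every `j` with `(k - 1) * j ≤ n` (`total_succ_le`). Together, `s (n + 1) ≤ ρ * s n + C * s (k * j)`,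
where `k * j` is about `n * k / (k - 1)`. A geometric bound of rate `b` therefore yields a forcing
term of the smaller rate `b ^ (k / (k - 1))`; iterating brings the rate down to `ρ`
(`exists_le_mul_pow_of_bootstrap`). A first geometric bound comes from the same Lyapunov estimate
(`exists_total_le_geometric`).

The minimum is then sandwiched: `P(M = n)` is at least the mass of `(n, …, n)`, hence at least a
constant times `s (k * n + 1)`, and at most `P(max > n - 1)`, hence at most a constant times `s (k *
(n - 1))`. Both have order `ρ ^ (k * n)`.

Existence follows from Cesàro averages kept tight by the same drift, uniqueness from a comparison of
two stationary laws. -/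

/-! ### Real sequences: geometrically forced recursions and the bootstrap. -/

lemma exists_le_mul_pow_of_recursion_lt {s : ℕ → ℝ} {a b B : ℝ} (ha : 0 ≤ a) (hab : a < b)
    (hB : 0 ≤ B) (hs0 : 0 ≤ s 0) (hs : ∀ n, s (n + 1) ≤ a * s n + B * b ^ (n + 1)) :
    ∃ K, 0 ≤ K ∧ ∀ n, s n ≤ K * b ^ n := by
  have hb : 0 < b := ha.trans_lt hab
  have hba : 0 < b - a := sub_pos.2 hab
  have hL : B * b / (b - a) * (b - a) = B * b := div_mul_cancel₀ _ hba.ne'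
  -- Any `K` with `K * (b - a) ≥ B * b` propagates through the recursion; `s 0` is added for the
  -- base case.
  refine ⟨s 0 + B * b / (b - a), by positivity, fun n => ?_⟩
  induction n with
  | zero => rw [pow_zero, mul_one]; exact le_add_of_nonneg_right (by positivity)
  | succ n ih =>
    refine (hs n).trans ?_
    have h1 := mul_le_mul_of_nonneg_left ih ha
    have h2 : B * b * b ^ n ≤ (s 0 + B * b / (b - a)) * (b - a) * b ^ n := by
      refine mul_le_mul_of_nonneg_right ?_ (by positivity)
      rw [add_mul, hL]
      exact le_add_of_nonneg_left (by positivity)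
    rw [pow_succ]
    linarith

lemma exists_le_mul_pow_of_recursion_gt {s : ℕ → ℝ} {a b B : ℝ} (hb : 0 ≤ b) (hba : b < a)
    (hB : 0 ≤ B) (hs : ∀ n, s (n + 1) ≤ a * s n + B * b ^ (n + 1)) :
    ∃ K, ∀ n, s n ≤ K * a ^ n := by
  have ha : 0 < a := hb.trans_lt hba
  have hab : 0 < a - b := sub_pos.2 hba
  set L := B * b / (a - b) with hLdef
  have hL : L * (a - b) = B * b := div_mul_cancel₀ _ hab.ne'
  have hL0 : 0 ≤ L := by positivity
  -- The induction needs the particular solution `-L * b ^ n` of the forced recursion; without it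
  -- the constant would grow at each step.
  have key : ∀ n, s n ≤ (s 0 + L) * a ^ n - L * b ^ n := by
    intro n
    induction n with
    | zero => simp
    | succ n ih =>
      refine (hs n).trans ?_
      have h1 := mul_le_mul_of_nonneg_left ih ha.le
      have h2 : L * (a - b) * b ^ n = B * b * b ^ n := by rw [hL]
      rw [pow_succ, pow_succ]
      linarith
  exact ⟨s 0 + L, fun n => (key n).trans (sub_le_self _ (by positivity))⟩

section Bootstrap

variable {k d : ℕ} {s : ℕ → ℝ} {ρ C : ℝ}

lemma exists_forcing_le (hk : 2 ≤ k) (hρ : 0 < ρ) (hC : 0 ≤ C) (hs0 : ∀ n, 0 ≤ s n)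
    (hs1 : ∀ n, s n ≤ 1)
    (hrec : ∀ n j, (k - 1) * j ≤ n → d ≤ j → s (n + 1) ≤ ρ * s n + C * s (k * j))
    {A b : ℝ} (hA : 0 ≤ A) (hb0 : 0 < b) (hb1 : b < 1) (hs : ∀ n, s n ≤ A * b ^ n) :
    ∃ B, 0 ≤ B ∧ ∀ n, s (n + 1) ≤ ρ * s n + B * (b ^ ((k : ℝ) / (k - 1))) ^ (n + 1) := by
  set p : ℝ := (k : ℝ) / (k - 1) with hp
  have hk1 : (0 : ℝ) < (k : ℝ) - 1 := by
    have : (2 : ℝ) ≤ k := by exact_mod_cast hk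
    linarith
  -- The first summand pays for rounding `n / (k - 1)` down. The second makes the forcing at least
  -- `1` for the small `n` at which the recursion is unavailable.
  refine ⟨C * A * b ^ (-(k : ℝ)) + b ^ (-((k : ℝ) * d)), by positivity, fun n => ?_⟩
  have hj1 : n + 1 ≤ (k - 1) * (n / (k - 1) + 1) :=
    Nat.succ_le_of_lt (Nat.lt_mul_div_succ n (by omega))
  set j := n / (k - 1) with hj
  have hpow : (b ^ p) ^ (n + 1) = b ^ (p * (n + 1 : ℕ)) := by
    rw [Real.rpow_mul hb0.le, Real.rpow_natCast]
  have hpn : ∀ i : ℕ, n + 1 ≤ (k - 1) * i → p * (n + 1 : ℕ) ≤ k * i := by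
    intro i hi
    have h1 : ((n + 1 : ℕ) : ℝ) ≤ ((k : ℝ) - 1) * i := by
      have : ((n + 1 : ℕ) : ℝ) ≤ (((k - 1) * i : ℕ) : ℝ) := by exact_mod_cast hi
      rwa [Nat.cast_mul, Nat.cast_sub (by omega), Nat.cast_one] at this
    rw [hp, div_mul_eq_mul_div, div_le_iff₀ hk1]
    have hk0 : (0 : ℝ) ≤ k := Nat.cast_nonneg k
    nlinarith
  rw [hpow, add_mul]
  have hx1 : 0 ≤ C * A * b ^ (-(k : ℝ)) * b ^ (p * (n + 1 : ℕ)) := by positivity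
  have hx2 : 0 ≤ b ^ (-((k : ℝ) * d)) * b ^ (p * (n + 1 : ℕ)) := by positivity
  have hx3 := mul_nonneg hρ.le (hs0 n)
  by_cases hdj : d ≤ j
  · have h1 := hrec n j (Nat.mul_div_le n (k - 1)) hdj
    have h2 : b ^ (k * j) ≤ b ^ (-(k : ℝ)) * b ^ (p * (n + 1 : ℕ)) := by
      rw [← Real.rpow_add hb0, ← Real.rpow_natCast]
      refine Real.rpow_le_rpow_of_exponent_ge hb0 hb1.le ?_
      have := hpn (j + 1) hj1
      push_cast at this ⊢
      linarith
    have h3 := mul_le_mul_of_nonneg_left ((hs (k * j)).trans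
      (mul_le_mul_of_nonneg_left h2 hA)) hC
    linarith
  · have h2 : 1 ≤ b ^ (-((k : ℝ) * d)) * b ^ (p * (n + 1 : ℕ)) := by
      rw [← Real.rpow_add hb0]
      refine Real.one_le_rpow_of_pos_of_le_one_of_nonpos hb0 hb1.le ?_
      have := hpn d (hj1.trans (Nat.mul_le_mul_left _ (by omega)))
      linarith
    have := hs1 (n + 1)
    linarith

/-- A geometric bound on a solution of the recursion can be improved to the rate `ρ`. -/
theorem exists_le_mul_pow_of_bootstrap (hk : 2 ≤ k) (hρ : 0 < ρ) (hρ1 : ρ < 1) (hC : 0 ≤ C)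
    (hs0 : ∀ n, 0 ≤ s n) (hs1 : ∀ n, s n ≤ 1)
    (hrec : ∀ n j, (k - 1) * j ≤ n → d ≤ j → s (n + 1) ≤ ρ * s n + C * s (k * j))
    {A r : ℝ} (hA : 0 ≤ A) (hr0 : 0 < r) (hr1 : r < 1) (hs : ∀ n, s n ≤ A * r ^ n) :
    ∃ K, ∀ n, s n ≤ K * ρ ^ n := by
  have hk1 : (0 : ℝ) < (k : ℝ) - 1 := by
    have : (2 : ℝ) ≤ k := by exact_mod_cast hk
    linarith
  set p : ℝ := (k : ℝ) / (k - 1) with hp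
  have hp1 : 1 < p := by rw [hp, lt_div_iff₀ hk1]; linarith
  have hp0 : 0 < p := by linarith
  obtain ⟨t, ht0, htρ, ht1, htp⟩ : ∃ t : ℝ, 0 < t ∧ ρ < t ∧ t < 1 ∧ t ^ p < ρ := by
    -- The exponent is the midpoint of `1 / p` and `1`.
    refine ⟨ρ ^ ((1 + p) / (2 * p)), by positivity, ?_, ?_, ?_⟩
    · refine Real.self_lt_rpow_of_lt_one hρ hρ1 ?_
      rw [div_lt_one (by positivity)]; linarith
    · exact Real.rpow_lt_one hρ.le hρ1 (by positivity)
    · rw [← Real.rpow_mul hρ.le]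
      refine Real.rpow_lt_self_of_lt_one hρ hρ1 ?_
      rw [div_mul_eq_mul_div, lt_div_iff₀ (by positivity)]
      nlinarith
  -- Each pass raises the rate to the power `p`. The floor `t > ρ` keeps the forcing dominant over
  -- the homogeneous rate.
  have hiter : ∀ i : ℕ, ∃ K, 0 ≤ K ∧ ∀ n, s n ≤ K * (max (r ^ (p ^ i)) t) ^ n := by
    intro i
    induction i with
    | zero =>
      refine ⟨A, hA, fun n => (hs n).trans ?_⟩
      rw [pow_zero, Real.rpow_one]
      gcongr
      exact le_max_left _ _
    | succ i ih =>
      obtain ⟨K, hK, hsK⟩ := ih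
      have hb0 : 0 < max (r ^ (p ^ i)) t := lt_max_of_lt_right ht0
      have hb1 : max (r ^ (p ^ i)) t < 1 :=
        max_lt (Real.rpow_lt_one hr0.le hr1 (by positivity)) ht1
      obtain ⟨B, hB, hsB⟩ := exists_forcing_le hk hρ hC hs0 hs1 hrec hK hb0 hb1 hsK
      have hle : (max (r ^ (p ^ i)) t) ^ p ≤ max (r ^ (p ^ (i + 1))) t := by
        rcases max_cases (r ^ (p ^ i)) t with ⟨h1, -⟩ | ⟨h1, -⟩
        · rw [h1, ← Real.rpow_mul hr0.le, ← pow_succ]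
          exact le_max_left _ _
        · rw [h1]
          exact (htp.trans htρ).le.trans (le_max_right _ _)
      refine exists_le_mul_pow_of_recursion_lt (B := B) hρ.le (htρ.trans_le (le_max_right _ _)) hB
        (hs0 0) fun n => (hsB n).trans ?_
      gcongr
  have hlim : Tendsto (fun i : ℕ => r ^ (p ^ i)) atTop (𝓝 0) :=
    (tendsto_rpow_atTop_of_base_lt_one r (by linarith) hr1).comp
      (tendsto_pow_atTop_atTop_of_one_lt hp1)
  obtain ⟨i, hi⟩ := (hlim.eventually (gt_mem_nhds ht0)).exists
  obtain ⟨K, hK, hsK⟩ := hiter i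
  rw [max_eq_right hi.le] at hsK
  -- One last pass from rate `t`: the forcing rate `t ^ p` is now below `ρ`, so the homogeneous rate
  -- wins.
  obtain ⟨B, hB, hsB⟩ := exists_forcing_le hk hρ hC hs0 hs1 hrec hK ht0 ht1 hsK
  exact exists_le_mul_pow_of_recursion_gt (by positivity) htp hB hsB

end Bootstrap

/-- Two-sided geometric bounds determine the exponential decay rate. -/
lemma tendsto_log_div_of_geometric_bounds {u : ℕ → ℝ} {q c₁ c₂ : ℝ} (hq : 0 < q) (hc₁ : 0 < c₁)
    (hl : ∀ᶠ n in atTop, c₁ * q ^ n ≤ u n) (hu : ∀ᶠ n in atTop, u n ≤ c₂ * q ^ n) :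
    Tendsto (fun n : ℕ => (1 / (n : ℝ)) * Real.log (u n)) atTop (𝓝 (Real.log q)) := by
  have hlim : ∀ c : ℝ, Tendsto (fun n : ℕ => (1 / (n : ℝ)) * Real.log c + Real.log q) atTop
      (𝓝 (Real.log q)) := fun c => by
    simpa using (tendsto_one_div_atTop_nhds_zero_nat.mul_const (Real.log c)).add_const (Real.log q)
  have heq : ∀ c : ℝ, 0 < c → ∀ n : ℕ, 0 < n → (1 / (n : ℝ)) * Real.log c + Real.log q
      = (1 / (n : ℝ)) * Real.log (c * q ^ n) := fun c hc n hn => by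
    rw [Real.log_mul hc.ne' (pow_pos hq n).ne', Real.log_pow]
    have : (n : ℝ) ≠ 0 := by exact_mod_cast hn.ne'
    field_simp
  refine tendsto_of_tendsto_of_tendsto_of_le_of_le' (hlim c₁) (hlim c₂) ?_ ?_
  · filter_upwards [hl, eventually_gt_atTop 0] with n hn h0
    rw [heq c₁ hc₁ n h0]
    gcongr
  · filter_upwards [hl, hu, eventually_gt_atTop 0] with n hn hn' h0
    have hpos : 0 < u n := (by positivity : 0 < c₁ * q ^ n).trans_le hn
    have hc₂ : 0 < c₂ := (mul_pos_iff_of_pos_right (pow_pos hq n)).1 (hpos.trans_le hn')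
    rw [heq c₂ hc₂ n h0]
    gcongr

/-! ### The one-step mean and stationarity. -/

variable {k : ℕ} {lam : ℝ} {mu : Fin k → ℝ}

/-- Positivity of the parameters of the queueing system. -/
structure PosParams (lam : ℝ) (mu : Fin k → ℝ) : Prop where
  two_le : 2 ≤ k
  lam_pos : 0 < lam
  mu_pos : ∀ i, 0 < mu i

namespace PosParams

lemma nonempty (h : PosParams lam mu) : Nonempty (Fin k) := ⟨⟨0, by have := h.two_le; omega⟩⟩

lemma sum_pos (h : PosParams lam mu) : 0 < ∑ i, mu i :=
  have := h.nonempty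
  Finset.sum_pos (fun i _ => h.mu_pos i) Finset.univ_nonempty

lemma totalRate_pos (h : PosParams lam mu) : 0 < totalRate lam mu :=
  add_pos h.lam_pos h.sum_pos

lemma trafficIntensity_pos (h : PosParams lam mu) : 0 < trafficIntensity lam mu :=
  div_pos h.lam_pos h.sum_pos

lemma arrivalProb_pos (h : PosParams lam mu) : 0 < lam / totalRate lam mu :=
  div_pos h.lam_pos h.totalRate_pos

lemma serviceProb_pos (h : PosParams lam mu) (i : Fin k) : 0 < mu i / totalRate lam mu :=
  div_pos (h.mu_pos i) h.totalRate_pos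

lemma prob_add (h : PosParams lam mu) :
    lam / totalRate lam mu + ∑ i, mu i / totalRate lam mu = 1 := by
  rw [← Finset.sum_div, ← add_div]
  exact div_self h.totalRate_pos.ne'

end PosParams

lemma minQueue_le (x : Fin k → ℕ) (j : Fin k) : minQueue x ≤ x j :=
  ciInf_le' _ j

lemma exists_eq_minQueue [Nonempty (Fin k)] (x : Fin k → ℕ) : ∃ i, x i = minQueue x :=
  Nat.sInf_mem (Set.range_nonempty x)

lemma mem_shortest {x : Fin k → ℕ} {i : Fin k} : i ∈ shortest x ↔ x i = minQueue x := by
  simp [shortest]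

lemma le_of_mem_shortest {x : Fin k → ℕ} {i : Fin k} (hi : i ∈ shortest x) (j : Fin k) :
    x i ≤ x j := by
  rw [mem_shortest.1 hi]; exact minQueue_le x j

lemma shortest_card_pos [Nonempty (Fin k)] (x : Fin k → ℕ) : 0 < (shortest x).card := by
  obtain ⟨i, hi⟩ := exists_eq_minQueue x
  exact Finset.card_pos.2 ⟨i, mem_shortest.2 hi⟩

/-- The mean of `f` after one step from state `x`. -/
noncomputable def stepMean (lam : ℝ) (mu : Fin k → ℝ) (f : (Fin k → ℕ) → ℝ) (x : Fin k → ℕ) : ℝ :=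
  ∑ i ∈ shortest x, lam / totalRate lam mu / (shortest x).card * f (arrive x i)
    + ∑ i, mu i / totalRate lam mu * f (depart x i)

lemma integral_stepLaw (h : PosParams lam mu) (f : (Fin k → ℕ) → ℝ) (x : Fin k → ℕ) :
    ∫ y, f y ∂(stepLaw lam mu x) = stepMean lam mu f x := by
  have hi : ∀ (c : ℝ) (y : Fin k → ℕ), Integrable f (ENNReal.ofReal c • Measure.dirac y) :=
    fun c y => (integrable_dirac (by simp)).smul_measure ENNReal.ofReal_ne_top
  rw [stepLaw, integral_add_measure, integral_finsetSum_measure, integral_finsetSum_measure,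
    stepMean]
  · congr 1
    · refine Finset.sum_congr rfl fun i _ => ?_
      rw [integral_smul_measure, integral_dirac, ENNReal.toReal_ofReal, smul_eq_mul]
      have := h.arrivalProb_pos
      positivity
    · refine Finset.sum_congr rfl fun i _ => ?_
      rw [integral_smul_measure, integral_dirac, ENNReal.toReal_ofReal, smul_eq_mul]
      exact (h.serviceProb_pos i).le
  · exact fun i _ => hi _ _
  · exact fun i _ => hi _ _
  · exact integrable_finsetSum_measure.2 fun i _ => hi _ _
  · exact integrable_finsetSum_measure.2 fun i _ => hi _ _

lemma stepMean_add (f g : (Fin k → ℕ) → ℝ) (x : Fin k → ℕ) :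
    stepMean lam mu (fun y => f y + g y) x = stepMean lam mu f x + stepMean lam mu g x := by
  simp only [stepMean, mul_add, Finset.sum_add_distrib]; ring

lemma stepMean_const_mul (c : ℝ) (f : (Fin k → ℕ) → ℝ) (x : Fin k → ℕ) :
    stepMean lam mu (fun y => c * f y) x = c * stepMean lam mu f x := by
  simp only [stepMean, mul_add, Finset.mul_sum]
  congr 1 <;> exact Finset.sum_congr rfl fun i _ => by ring

lemma sum_shortest_weight (h : PosParams lam mu) (c : ℝ) (x : Fin k → ℕ) :
    ∑ _i ∈ shortest x, lam / totalRate lam mu / (shortest x).card * c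
      = lam / totalRate lam mu * c := by
  have := h.nonempty
  have hc : ((shortest x).card : ℝ) ≠ 0 := by exact_mod_cast (shortest_card_pos x).ne'
  rw [Finset.sum_const, nsmul_eq_mul]
  field_simp

lemma stepMean_const (h : PosParams lam mu) (c : ℝ) (x : Fin k → ℕ) :
    stepMean lam mu (fun _ => c) x = c := by
  rw [stepMean, sum_shortest_weight h, ← Finset.sum_mul, ← add_mul, h.prob_add, one_mul]

lemma stepMean_le_stepMean (h : PosParams lam mu) {f g : (Fin k → ℕ) → ℝ} {x : Fin k → ℕ}
    (ha : ∀ i ∈ shortest x, f (arrive x i) ≤ g (arrive x i))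
    (hd : ∀ i, f (depart x i) ≤ g (depart x i)) :
    stepMean lam mu f x ≤ stepMean lam mu g x := by
  have := h.arrivalProb_pos
  refine add_le_add (Finset.sum_le_sum fun i hi => ?_) (Finset.sum_le_sum fun i _ => ?_)
  · exact mul_le_mul_of_nonneg_left (ha i hi) (by positivity)
  · exact mul_le_mul_of_nonneg_left (hd i) (h.serviceProb_pos i).le

lemma stepMean_mono (h : PosParams lam mu) {f g : (Fin k → ℕ) → ℝ} (hfg : ∀ x, f x ≤ g x)
    (x : Fin k → ℕ) : stepMean lam mu f x ≤ stepMean lam mu g x :=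
  stepMean_le_stepMean h (fun _ _ => hfg _) (fun _ => hfg _)

lemma stepMean_le_of_le (h : PosParams lam mu) {f : (Fin k → ℕ) → ℝ} {x : Fin k → ℕ} {c : ℝ}
    (ha : ∀ i ∈ shortest x, f (arrive x i) ≤ c) (hd : ∀ i, f (depart x i) ≤ c) :
    stepMean lam mu f x ≤ c :=
  (stepMean_le_stepMean h (g := fun _ => c) ha hd).trans_eq (stepMean_const h c x)

lemma le_stepMean_of_le (h : PosParams lam mu) {f : (Fin k → ℕ) → ℝ} {x : Fin k → ℕ} {c : ℝ}
    (ha : ∀ i ∈ shortest x, c ≤ f (arrive x i)) (hd : ∀ i, c ≤ f (depart x i)) :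
    c ≤ stepMean lam mu f x :=
  (stepMean_const h c x).symm.trans_le (stepMean_le_stepMean h (f := fun _ => c) ha hd)

lemma isMarkovKernel_chain (h : PosParams lam mu) : IsMarkovKernel (chain lam mu) := by
  refine ⟨fun x => ⟨?_⟩⟩
  have h1 := integral_stepLaw h (fun _ => (1 : ℝ)) x
  rw [stepMean_const h] at h1
  have h2 : (stepLaw lam mu x).real Set.univ = 1 := by simpa using h1
  change stepLaw lam mu x Set.univ = 1
  rwa [Measure.real, ENNReal.toReal_eq_one_iff] at h2

lemma integrable_of_bdd {π : Measure (Fin k → ℕ)} [IsFiniteMeasure π] {f : (Fin k → ℕ) → ℝ}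
    {c : ℝ} (hf : ∀ x, |f x| ≤ c) : Integrable f π :=
  Integrable.of_bound (Measurable.of_discrete.aestronglyMeasurable) c (ae_of_all _ hf)

lemma abs_stepMean_le (h : PosParams lam mu) {f : (Fin k → ℕ) → ℝ} {c : ℝ}
    (hf : ∀ x, |f x| ≤ c) (x : Fin k → ℕ) : |stepMean lam mu f x| ≤ c :=
  abs_le.2 ⟨le_stepMean_of_le h (fun _ _ => (abs_le.1 (hf _)).1) (fun _ => (abs_le.1 (hf _)).1),
    stepMean_le_of_le h (fun _ _ => (abs_le.1 (hf _)).2) (fun _ => (abs_le.1 (hf _)).2)⟩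

lemma integral_bind_chain (h : PosParams lam mu) (π : Measure (Fin k → ℕ)) [IsFiniteMeasure π]
    {f : (Fin k → ℕ) → ℝ} {c : ℝ} (hf : ∀ x, |f x| ≤ c) :
    ∫ x, f x ∂(π.bind (chain lam mu)) = ∫ x, stepMean lam mu f x ∂π := by
  have := isMarkovKernel_chain h
  have hcomp : ((chain lam mu) ∘ₖ (Kernel.const Unit π)) () = π.bind (chain lam mu) := by
    rw [Kernel.comp_apply, Kernel.const_apply]
  rw [← hcomp, Kernel.integral_comp (integrable_of_bdd hf), Kernel.const_apply]
  exact integral_congr_ae (ae_of_all _ fun x => integral_stepLaw h f x)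

/-- The form in which stationarity is mostly used. Boundedness is required, so Lyapunov functions
have to be truncated before integration. -/
lemma IsStationary.integral_drift (h : PosParams lam mu) {π : Measure (Fin k → ℕ)}
    (hπ : IsStationary lam mu π) {f : (Fin k → ℕ) → ℝ} {c : ℝ} (hf : ∀ x, |f x| ≤ c) :
    ∫ x, (stepMean lam mu f x - f x) ∂π = 0 := by
  have := hπ.1
  rw [integral_sub (integrable_of_bdd (abs_stepMean_le h hf)) (integrable_of_bdd hf),
    ← integral_bind_chain h π hf, show π.bind (chain lam mu) = π from hπ.2, sub_self]

/-! ### Lyapunov drift and the longest queue. -/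

/-- The Lyapunov function: the sum of the squared excesses of the queue lengths over level `a`. -/
def excess (a : ℕ) (x : Fin k → ℕ) : ℝ := ∑ i, ((x i - a : ℕ) : ℝ) ^ 2

lemma excess_nonneg (a : ℕ) (x : Fin k → ℕ) : 0 ≤ excess a x :=
  Finset.sum_nonneg fun _ _ => sq_nonneg _

lemma excess_update (a : ℕ) (x : Fin k → ℕ) (i : Fin k) (v : ℕ) :
    excess a (Function.update x i v)
      = excess a x + (((v - a : ℕ) : ℝ) ^ 2 - ((x i - a : ℕ) : ℝ) ^ 2) := by
  unfold excess
  rw [← Finset.add_sum_erase _ _ (Finset.mem_univ i), ← Finset.add_sum_erase _ _ (Finset.mem_univ i),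
    Finset.sum_congr rfl (g := fun j => ((x j - a : ℕ) : ℝ) ^ 2)
      fun j hj => by rw [Function.update_of_ne (Finset.ne_of_mem_erase hj)]]
  rw [Function.update_self]; ring

lemma excess_arrive_le (a : ℕ) (x : Fin k → ℕ) (i : Fin k) :
    excess a (arrive x i) ≤ excess a x + (1 + 2 * ((x i - a : ℕ) : ℝ)) := by
  rw [arrive, excess_update]
  have h1 : ((x i + 1 - a : ℕ) : ℝ) ≤ ((x i - a : ℕ) : ℝ) + 1 := by
    have : x i + 1 - a ≤ (x i - a) + 1 := by omega
    exact_mod_cast this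
  have h0 : (0 : ℝ) ≤ ((x i + 1 - a : ℕ) : ℝ) := Nat.cast_nonneg _
  nlinarith

lemma excess_depart_le (a : ℕ) (x : Fin k → ℕ) (i : Fin k) :
    excess a (depart x i) ≤ excess a x + (1 + -2 * ((x i - a : ℕ) : ℝ)) := by
  rw [depart, excess_update]
  rcases Nat.eq_zero_or_pos (x i - a) with h0 | h0
  · have : x i - 1 - a = 0 := by omega
    rw [h0, this]; norm_num
  · have : ((x i - a : ℕ) : ℝ) = ((x i - 1 - a : ℕ) : ℝ) + 1 := by
      have : x i - a = (x i - 1 - a) + 1 := by omega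
      exact_mod_cast this
    rw [this]; linarith

/-- The excess of a shortest queue is at most the `mu`-weighted average excess, so the linear term
added by arrivals is at most `ρ` times the one removed by services. -/
lemma stepMean_excess_le (h : PosParams lam mu) (a : ℕ) (x : Fin k → ℕ) :
    stepMean lam mu (excess a) x ≤ excess a x + 1
      - 2 * (1 - trafficIntensity lam mu) * ∑ i, mu i / totalRate lam mu * ((x i - a : ℕ) : ℝ) := by
  set Y := ∑ i, mu i / totalRate lam mu * ((x i - a : ℕ) : ℝ) with hY
  have hA := h.arrivalProb_pos
  have hΛ := h.totalRate_pos
  have hS := h.sum_pos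
  have harr : ∑ i ∈ shortest x, lam / totalRate lam mu / (shortest x).card
        * excess a (arrive x i)
      ≤ lam / totalRate lam mu * (excess a x + 1) + 2 * trafficIntensity lam mu * Y := by
    have key : ∀ i ∈ shortest x, lam / totalRate lam mu * ((x i - a : ℕ) : ℝ)
        ≤ trafficIntensity lam mu * Y := by
      intro i hi
      have h1 : ∑ j, mu j / totalRate lam mu * ((x i - a : ℕ) : ℝ) ≤ Y := by
        refine Finset.sum_le_sum fun j _ => mul_le_mul_of_nonneg_left ?_ (h.serviceProb_pos j).le
        exact_mod_cast Nat.sub_le_sub_right (le_of_mem_shortest hi j) a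
      rw [← Finset.sum_mul, ← Finset.sum_div] at h1
      calc lam / totalRate lam mu * ((x i - a : ℕ) : ℝ)
          = trafficIntensity lam mu * ((∑ j, mu j) / totalRate lam mu * ((x i - a : ℕ) : ℝ)) := by
            rw [trafficIntensity]; field_simp
        _ ≤ _ := mul_le_mul_of_nonneg_left h1 h.trafficIntensity_pos.le
    calc _ ≤ ∑ i ∈ shortest x, lam / totalRate lam mu / (shortest x).card
          * (excess a x + 1 + 2 * trafficIntensity lam mu * Y / (lam / totalRate lam mu)) := by
          refine Finset.sum_le_sum fun i hi => mul_le_mul_of_nonneg_left ?_ (by positivity)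
          have h1 : ((x i - a : ℕ) : ℝ) ≤ trafficIntensity lam mu * Y / (lam / totalRate lam mu) := by
            rw [le_div_iff₀ hA, mul_comm]; exact key i hi
          have h2 := excess_arrive_le a x i
          rw [mul_assoc, mul_div_assoc]
          linarith
      _ = _ := by
          rw [sum_shortest_weight h, mul_add, mul_div_cancel₀ _ hA.ne']
  have hdep : ∑ i, mu i / totalRate lam mu * excess a (depart x i)
      ≤ (∑ i, mu i / totalRate lam mu) * (excess a x + 1) - 2 * Y := by
    rw [hY, Finset.mul_sum, Finset.sum_mul, ← Finset.sum_sub_distrib]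
    refine Finset.sum_le_sum fun i _ => ?_
    have := mul_le_mul_of_nonneg_left (excess_depart_le a x i) (h.serviceProb_pos i).le
    linarith
  have hsum : lam / totalRate lam mu * (excess a x + 1)
      + (∑ i, mu i / totalRate lam mu) * (excess a x + 1) = excess a x + 1 := by
    rw [← add_mul, h.prob_add, one_mul]
  unfold stepMean
  linarith

/-- Far above level `a`, the drift of `excess a` is at most `-1`. -/
lemma exists_drift_le (h : PosParams lam mu) (hstab : trafficIntensity lam mu < 1) :
    ∃ d : ℕ, ∀ (a : ℕ) (x : Fin k → ℕ), (∃ j, a + d < x j) →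
      stepMean lam mu (excess a) x ≤ excess a x - 1 := by
  -- The bound `2` absorbs the `+ 1` of the drift estimate and leaves `-1`.
  have hex : ∀ j, ∃ d : ℕ, 2 < d * (2 * (1 - trafficIntensity lam mu) * (mu j / totalRate lam mu)) := by
    intro j
    have h1 := h.serviceProb_pos j
    obtain ⟨d, hd⟩ := exists_nat_gt (2 / (2 * (1 - trafficIntensity lam mu) * (mu j / totalRate lam mu)))
    exact ⟨d, (div_lt_iff₀ (mul_pos (by linarith) h1)).1 hd⟩
  choose d hd using hex
  refine ⟨∑ j, d j, fun a x ⟨j, hj⟩ => (stepMean_excess_le h a x).trans ?_⟩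
  have h1 : mu j / totalRate lam mu * ((x j - a : ℕ) : ℝ)
      ≤ ∑ i, mu i / totalRate lam mu * ((x i - a : ℕ) : ℝ) :=
    Finset.single_le_sum (f := fun i => mu i / totalRate lam mu * ((x i - a : ℕ) : ℝ))
      (fun i _ => mul_nonneg (h.serviceProb_pos i).le (Nat.cast_nonneg _)) (Finset.mem_univ j)
  have h2 : (d j : ℝ) ≤ ((x j - a : ℕ) : ℝ) := by
    have : d j ≤ ∑ j, d j := Finset.single_le_sum (fun _ _ => Nat.zero_le _) (Finset.mem_univ j)
    exact_mod_cast (by omega : d j ≤ x j - a)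
  have h3 := mul_le_mul_of_nonneg_left h2 (h.serviceProb_pos j).le
  have h4 := mul_le_mul_of_nonneg_left (h3.trans h1)
    (by linarith : 0 ≤ 2 * (1 - trafficIntensity lam mu))
  have h5 := hd j
  linarith

lemma depart_le (x : Fin k → ℕ) (i j : Fin k) : depart x i j ≤ x j := by
  unfold depart
  rcases eq_or_ne j i with rfl | hne
  · rw [Function.update_self]; omega
  · rw [Function.update_of_ne hne]

lemma arrive_le (x : Fin k → ℕ) (i j : Fin k) : arrive x i j ≤ x j + 1 := by
  unfold arrive
  rcases eq_or_ne j i with rfl | hne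
  · rw [Function.update_self]
  · rw [Function.update_of_ne hne]; omega

/-- The longest queue can exceed `m` only by an arrival in the state where all queues have
length `m`. -/
lemma arrive_le_of_le {x : Fin k → ℕ} {m : ℕ} (hx : ∀ j, x j ≤ m) (hne : x ≠ fun _ => m)
    {i : Fin k} (hi : i ∈ shortest x) (j : Fin k) : arrive x i j ≤ m := by
  unfold arrive
  rcases eq_or_ne j i with rfl | hji
  · rw [Function.update_self]
    by_contra! hcon
    exact hne (funext fun l => le_antisymm (hx l) (by have := le_of_mem_shortest hi l; omega))
  · rw [Function.update_of_ne hji]; exact hx j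

/-- The states in which some queue is longer than `m`. -/
def longer (k m : ℕ) : Set (Fin k → ℕ) := {x | ∃ j, m < x j}

lemma excess_le_of_le {a d : ℕ} {x : Fin k → ℕ} (hx : ∀ j, x j ≤ a + d) :
    excess a x ≤ k * (d : ℝ) ^ 2 := by
  refine (Finset.sum_le_sum (g := fun _ => (d : ℝ) ^ 2) fun i _ => ?_).trans_eq (by simp)
  have : x i - a ≤ d := by have := hx i; omega
  gcongr

/-- Cutting the Lyapunov function to zero outside `longer k m` makes the balanced state the only
source of positive drift: from any other state outside, one step stays outside. One step from the
balanced state gives lengths at most `m + 1 = (m - d) + (d + 1)`, whence the constant. Truncation at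
`N` gives boundedness and costs only the drift above `N`. -/
lemma drift_min_indicator_le (h : PosParams lam mu) {d m : ℕ} (hdm : d ≤ m)
    (hd : ∀ (a : ℕ) (x : Fin k → ℕ), (∃ j, a + d < x j) →
      stepMean lam mu (excess a) x ≤ excess a x - 1) (N : ℕ) (x : Fin k → ℕ) :
    stepMean lam mu (fun y => min ((longer k m).indicator (excess (m - d)) y) N) x
        - min ((longer k m).indicator (excess (m - d)) x) N
      ≤ k * ((d + 1 : ℕ) : ℝ) ^ 2 * ({fun _ => m} : Set (Fin k → ℕ)).indicator 1 x
        - (longer k m ∩ {y | excess (m - d) y ≤ N}).indicator 1 x := by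
  set g := (longer k m).indicator (excess (k := k) (m - d)) with hg
  have hg_le : ∀ y, g y ≤ excess (m - d) y := fun y =>
    Set.indicator_le_self' (fun _ _ => excess_nonneg _ _) y
  have hg_zero : ∀ y, (∀ j, y j ≤ m) → g y = 0 := fun y hy =>
    Set.indicator_of_notMem (by rintro ⟨j, hj⟩; have := hy j; omega) _
  have hN : (0 : ℝ) ≤ N := Nat.cast_nonneg N
  by_cases hx : x ∈ longer k m
  · have hxm : x ∉ ({fun _ => m} : Set (Fin k → ℕ)) := by
      rintro rfl; obtain ⟨j, hj⟩ := hx; exact lt_irrefl _ hj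
    rw [Set.indicator_of_notMem hxm]
    have hgx : g x = excess (m - d) x := Set.indicator_of_mem hx _
    by_cases hxN : excess (m - d) x ≤ N
    · rw [Set.indicator_of_mem (show x ∈ longer k m ∩ {y | excess (m - d) y ≤ N} from ⟨hx, hxN⟩), hgx, min_eq_left hxN]
      have h1 := hd (m - d) x (by rwa [Nat.sub_add_cancel hdm])
      have h2 := stepMean_mono h (fun y => (min_le_left (g y) (N : ℝ)).trans (hg_le y)) x
      simp only [Pi.one_apply]
      linarith
    · rw [Set.indicator_of_notMem
        (show x ∉ longer k m ∩ {y | excess (m - d) y ≤ N} from fun hh => hxN hh.2), hgx, min_eq_right (not_le.1 hxN).le]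
      have := stepMean_le_of_le h (x := x) (f := fun y => min (g y) (N : ℝ)) (c := N)
        (fun _ _ => min_le_right _ _) (fun _ => min_le_right _ _)
      linarith
  · have hxle : ∀ j, x j ≤ m := fun j => not_lt.1 fun hj => hx ⟨j, hj⟩
    rw [hg_zero x hxle, min_eq_left hN, Set.indicator_of_notMem
      (show x ∉ longer k m ∩ {y | excess (m - d) y ≤ N} from fun hh => hx hh.1)]
    by_cases hxm : x = fun _ => m
    · rw [Set.indicator_of_mem (show x ∈ ({fun _ => m} : Set (Fin k → ℕ)) from hxm)]
      have := stepMean_le_of_le h (x := x) (f := fun y => min (g y) (N : ℝ))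
        (c := k * ((d + 1 : ℕ) : ℝ) ^ 2)
        (fun i _ => (min_le_left _ _).trans <| (hg_le _).trans <| excess_le_of_le fun j => by
          have := arrive_le x i j; have := hxle j; omega)
        (fun i => (min_le_left _ _).trans <| (hg_le _).trans <| excess_le_of_le fun j => by
          have := depart_le x i j; have := hxle j; omega)
      simp only [Pi.one_apply]
      linarith
    · rw [Set.indicator_of_notMem (show x ∉ ({fun _ => m} : Set (Fin k → ℕ)) from hxm)]
      have := stepMean_le_of_le h (x := x) (f := fun y => min (g y) (N : ℝ)) (c := 0)
        (fun i hi => (min_le_left _ _).trans (hg_zero _ (arrive_le_of_le hxle hxm hi)).le)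
        (fun i => (min_le_left _ _).trans
          (hg_zero _ fun j => (depart_le x i j).trans (hxle j)).le)
      linarith

lemma integral_indicator_real {π : Measure (Fin k → ℕ)} (A : Set (Fin k → ℕ)) :
    ∫ x, A.indicator (1 : (Fin k → ℕ) → ℝ) x ∂π = π.real A :=
  integral_indicator_one (.of_discrete)

lemma abs_indicator_one_le (A : Set (Fin k → ℕ)) (x : Fin k → ℕ) :
    |A.indicator (1 : (Fin k → ℕ) → ℝ) x| ≤ 1 := by
  by_cases hx : x ∈ A <;> simp [hx]

lemma integrable_indicator_real {π : Measure (Fin k → ℕ)} [IsFiniteMeasure π]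
    (A : Set (Fin k → ℕ)) : Integrable (fun x => A.indicator (1 : (Fin k → ℕ) → ℝ) x) π :=
  integrable_of_bdd (abs_indicator_one_le A)

/-- The tail of the longest queue is controlled by the balanced states. -/
theorem exists_longer_le (h : PosParams lam mu) (hstab : trafficIntensity lam mu < 1) :
    ∃ (d : ℕ) (C : ℝ), 0 < C ∧ ∀ π : Measure (Fin k → ℕ), IsStationary lam mu π → ∀ m, d ≤ m →
      π.real (longer k m) ≤ C * π.real {fun _ => m} := by
  obtain ⟨d, hd⟩ := exists_drift_le h hstab
  have hk : (0 : ℝ) < k := by have := h.two_le; exact_mod_cast (by omega : 0 < k)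
  refine ⟨d, k * ((d + 1 : ℕ) : ℝ) ^ 2, by positivity, fun π hπ m hdm => ?_⟩
  have := hπ.1
  have hN : ∀ N : ℕ, π.real (longer k m ∩ {y | excess (m - d) y ≤ N})
      ≤ k * ((d + 1 : ℕ) : ℝ) ^ 2 * π.real {fun _ => m} := by
    intro N
    have hbdd : ∀ x, |min ((longer k m).indicator (excess (m - d)) x) (N : ℝ)| ≤ N := fun x => by
      rw [abs_of_nonneg (le_min (Set.indicator_nonneg (fun _ _ => excess_nonneg _ _) _)
        (Nat.cast_nonneg _))]
      exact min_le_right _ _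
    have h1 := hπ.integral_drift h hbdd
    have h2 := integral_mono (μ := π)
      ((integrable_of_bdd (abs_stepMean_le h hbdd)).sub (integrable_of_bdd hbdd))
      (((integrable_indicator_real _).const_mul _).sub (integrable_indicator_real _))
      (drift_min_indicator_le h hdm hd N)
    have h3 := h1.symm.trans_le h2
    simp only [Pi.sub_apply] at h3
    rw [integral_sub ((integrable_indicator_real _).const_mul _) (integrable_indicator_real _),
      integral_const_mul, integral_indicator_real, integral_indicator_real] at h3
    linarith
  -- The bound is uniform in `N`, so continuity from below removes the truncation.
  have hlim : Tendsto (fun N : ℕ => π (longer k m ∩ {y | excess (m - d) y ≤ N})) atTop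
      (𝓝 (π (⋃ N : ℕ, longer k m ∩ {y | excess (m - d) y ≤ N}))) := by
    refine tendsto_measure_iUnion_atTop fun N N' hNN x hx => ⟨hx.1, ?_⟩
    exact le_trans (Set.mem_ofPred_eq ▸ hx.2) (Nat.cast_le.2 hNN)
  have hU : (⋃ N : ℕ, longer k m ∩ {y | excess (m - d) y ≤ N}) = longer k m := by
    ext x
    simp only [Set.mem_iUnion, Set.mem_inter_iff, Set.mem_ofPred_eq, exists_and_left,
      and_iff_left_iff_imp]
    exact fun _ => exists_nat_ge _
  rw [hU] at hlim
  exact le_of_tendsto' ((ENNReal.tendsto_toReal (measure_ne_top π _)).comp hlim) hN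

/-! ### The number of customers and the flow across its levels. -/

lemma sum_arrive (x : Fin k → ℕ) (i : Fin k) : ∑ j, arrive x i j = ∑ j, x j + 1 := by
  unfold arrive
  rw [Finset.sum_update_of_mem (Finset.mem_univ i),
    ← Finset.add_sum_erase _ x (Finset.mem_univ i), Finset.sdiff_singleton_eq_erase]
  omega

lemma sum_depart (x : Fin k → ℕ) (i : Fin k) (hi : 0 < x i) :
    ∑ j, depart x i j + 1 = ∑ j, x j := by
  unfold depart
  rw [Finset.sum_update_of_mem (Finset.mem_univ i),
    ← Finset.add_sum_erase _ x (Finset.mem_univ i), Finset.sdiff_singleton_eq_erase]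
  omega

lemma sum_depart_le (x : Fin k → ℕ) (i : Fin k) : ∑ j, depart x i j ≤ ∑ j, x j :=
  Finset.sum_le_sum fun j _ => depart_le x i j

lemma le_sum_depart (x : Fin k → ℕ) (i : Fin k) : ∑ j, x j ≤ ∑ j, depart x i j + 1 := by
  rcases Nat.eq_zero_or_pos (x i) with h0 | h0
  · have : depart x i = x := by
      unfold depart; rw [h0]; exact Function.update_eq_self_iff.2 h0.symm
    rw [this]; omega
  · exact (sum_depart x i h0).ge

/-- A nonempty set of states that is closed under service completions contains the empty state. -/
lemma zero_mem_of_depart_mem {A : Set (Fin k → ℕ)} (hA : ∀ x ∈ A, ∀ i, depart x i ∈ A)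
    (hne : A.Nonempty) : 0 ∈ A := by
  have key : ∀ n, ∀ x ∈ A, ∑ j, x j = n → 0 ∈ A := by
    intro n
    induction n with
    | zero =>
      intro x hx hs
      have : x = 0 := funext fun j => Finset.sum_eq_zero_iff.1 hs j (Finset.mem_univ j)
      exact this ▸ hx
    | succ n ih =>
      intro x hx hs
      obtain ⟨i, -, hi⟩ : ∃ i ∈ Finset.univ, x i ≠ 0 := by
        by_contra! hcon
        rw [Finset.sum_eq_zero hcon] at hs; omega
      have := sum_depart x i (Nat.pos_of_ne_zero hi)
      exact ih (depart x i) (hA x hx i) (by omega)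
  obtain ⟨x, hx⟩ := hne
  exact key _ x hx rfl

lemma le_stepMean_depart (h : PosParams lam mu) {f : (Fin k → ℕ) → ℝ} (hf : ∀ x, 0 ≤ f x)
    (x : Fin k → ℕ) (i : Fin k) :
    mu i / totalRate lam mu * f (depart x i) ≤ stepMean lam mu f x := by
  have h1 := Finset.single_le_sum (f := fun i => mu i / totalRate lam mu * f (depart x i))
      (fun i _ => mul_nonneg (h.serviceProb_pos i).le (hf _)) (Finset.mem_univ i)
  have := h.arrivalProb_pos
  have h2 : 0 ≤ ∑ i ∈ shortest x, lam / totalRate lam mu / (shortest x).card * f (arrive x i) :=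
    Finset.sum_nonneg fun i _ => mul_nonneg (by positivity) (hf _)
  exact h1.trans (le_add_of_nonneg_left h2)

lemma stepMean_le_add (h : PosParams lam mu) {f : (Fin k → ℕ) → ℝ} {x : Fin k → ℕ} {a b : ℝ}
    (ha : ∀ i ∈ shortest x, f (arrive x i) ≤ a) (hd : ∀ i, f (depart x i) ≤ b) :
    stepMean lam mu f x
      ≤ lam / totalRate lam mu * a + (∑ i, mu i) / totalRate lam mu * b := by
  have := h.arrivalProb_pos
  rw [Finset.sum_div, Finset.sum_mul, ← sum_shortest_weight h a x]
  exact add_le_add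
    (Finset.sum_le_sum fun i hi => mul_le_mul_of_nonneg_left (ha i hi) (by positivity))
    (Finset.sum_le_sum fun i _ => mul_le_mul_of_nonneg_left (hd i) (h.serviceProb_pos i).le)

lemma add_le_stepMean (h : PosParams lam mu) {f : (Fin k → ℕ) → ℝ} {x : Fin k → ℕ} {a b : ℝ}
    (ha : ∀ i ∈ shortest x, a ≤ f (arrive x i)) (hd : ∀ i, b ≤ f (depart x i)) :
    lam / totalRate lam mu * a + (∑ i, mu i) / totalRate lam mu * b ≤ stepMean lam mu f x := by
  have := h.arrivalProb_pos
  rw [Finset.sum_div, Finset.sum_mul, ← sum_shortest_weight h a x]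
  exact add_le_add
    (Finset.sum_le_sum fun i hi => mul_le_mul_of_nonneg_left (ha i hi) (by positivity))
    (Finset.sum_le_sum fun i _ => mul_le_mul_of_nonneg_left (hd i) (h.serviceProb_pos i).le)

/-- The states with `n` customers. -/
def total (k n : ℕ) : Set (Fin k → ℕ) := {x | ∑ i, x i = n}

lemma mem_total {n : ℕ} {x : Fin k → ℕ} : x ∈ total k n ↔ ∑ i, x i = n := Iff.rfl

/-- The states in which all servers are busy. -/
def busy (k : ℕ) : Set (Fin k → ℕ) := {x | ∀ i, 0 < x i}

/-- The states with at most `n` customers. -/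
def totalLE (k n : ℕ) : Set (Fin k → ℕ) := {x | ∑ i, x i ≤ n}

/-- Net flow into `totalLE k n`: arrivals leave only from level `n`, and services enter only from
level `n + 1`, at no more than the full service rate. -/
lemma stepMean_totalLE_le (h : PosParams lam mu) (n : ℕ) (x : Fin k → ℕ) :
    stepMean lam mu ((totalLE k n).indicator 1) x - (totalLE k n).indicator 1 x
      ≤ (∑ i, mu i) / totalRate lam mu * (total k (n + 1)).indicator 1 x
        - lam / totalRate lam mu * (total k n).indicator 1 x := by
  have hone : ∀ y, (totalLE k n).indicator (1 : (Fin k → ℕ) → ℝ) y ≤ 1 := fun y =>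
    (abs_le.1 (abs_indicator_one_le _ y)).2
  have hout : ∀ y, n < ∑ i, y i → (totalLE k n).indicator (1 : (Fin k → ℕ) → ℝ) y ≤ 0 :=
    fun y hy => (Set.indicator_of_notMem (show y ∉ totalLE k n from not_le.2 hy) _).le
  have hadd := h.prob_add
  rw [← Finset.sum_div] at hadd
  rcases lt_trichotomy (∑ i, x i) n with hn | hn | hn
  · rw [Set.indicator_of_mem (show x ∈ totalLE k n from hn.le),
      Set.indicator_of_notMem (show x ∉ total k n from hn.ne),
      Set.indicator_of_notMem (show x ∉ total k (n + 1) from by rw [mem_total]; omega)]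
    have := stepMean_le_of_le h (x := x) (fun _ _ => hone _) (fun _ => hone _)
    simpa using this
  · rw [Set.indicator_of_mem (show x ∈ totalLE k n from hn.le),
      Set.indicator_of_mem (show x ∈ total k n from hn),
      Set.indicator_of_notMem (show x ∉ total k (n + 1) from by rw [mem_total]; omega)]
    have := stepMean_le_add h (x := x) (f := (totalLE k n).indicator 1) (a := 0) (b := 1)
      (fun i _ => hout _ (by rw [sum_arrive]; omega)) (fun _ => hone _)
    simp only [Pi.one_apply]
    linarith
  · rw [Set.indicator_of_notMem (show x ∉ totalLE k n from not_le.2 hn),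
      Set.indicator_of_notMem (show x ∉ total k n from hn.ne')]
    by_cases hn1 : ∑ i, x i = n + 1
    · rw [Set.indicator_of_mem (show x ∈ total k (n + 1) from hn1)]
      have := stepMean_le_add h (x := x) (f := (totalLE k n).indicator 1) (a := 0) (b := 1)
        (fun i _ => hout _ (by rw [sum_arrive]; omega)) (fun _ => hone _)
      simp only [Pi.one_apply]
      linarith
    · rw [Set.indicator_of_notMem (show x ∉ total k (n + 1) from hn1)]
      have := stepMean_le_of_le h (x := x) (f := (totalLE k n).indicator 1) (c := 0)
        (fun i _ => hout _ (by rw [sum_arrive]; omega))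
        (fun i => hout _ (by have := le_sum_depart x i; omega))
      linarith

/-- The reverse estimate keeps only the states in which every server is busy, where the service rate
is full. -/
lemma le_stepMean_totalLE (h : PosParams lam mu) (n : ℕ) (x : Fin k → ℕ) :
    (∑ i, mu i) / totalRate lam mu * (total k (n + 1) ∩ busy k).indicator 1 x
        - lam / totalRate lam mu * (total k n).indicator 1 x
      ≤ stepMean lam mu ((totalLE k n).indicator 1) x - (totalLE k n).indicator 1 x := by
  have hzero : ∀ y, 0 ≤ (totalLE k n).indicator (1 : (Fin k → ℕ) → ℝ) y := fun y =>
    Set.indicator_nonneg (fun _ _ => zero_le_one) y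
  have hin : ∀ y, ∑ i, y i ≤ n → 1 ≤ (totalLE k n).indicator (1 : (Fin k → ℕ) → ℝ) y :=
    fun y hy =>
    (Set.indicator_of_mem (show y ∈ totalLE k n from hy) (1 : (Fin k → ℕ) → ℝ)).ge
  have hadd := h.prob_add
  rw [← Finset.sum_div] at hadd
  rcases lt_trichotomy (∑ i, x i) n with hn | hn | hn
  · rw [Set.indicator_of_mem (show x ∈ totalLE k n from hn.le),
      Set.indicator_of_notMem (show x ∉ total k n from hn.ne),
      Set.indicator_of_notMem (show x ∉ total k (n + 1) ∩ busy k from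
        fun hx => by have := mem_total.1 hx.1; omega)]
    have := le_stepMean_of_le h (x := x) (f := (totalLE k n).indicator 1) (c := 1)
      (fun i _ => hin _ (by rw [sum_arrive]; omega))
      (fun i => hin _ ((sum_depart_le x i).trans hn.le))
    simp only [Pi.one_apply]
    linarith
  · rw [Set.indicator_of_mem (show x ∈ totalLE k n from hn.le),
      Set.indicator_of_mem (show x ∈ total k n from hn),
      Set.indicator_of_notMem (show x ∉ total k (n + 1) ∩ busy k from
        fun hx => by have := mem_total.1 hx.1; omega)]
    have := add_le_stepMean h (x := x) (f := (totalLE k n).indicator 1) (a := 0) (b := 1)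
      (fun i _ => hzero _) (fun i => hin _ ((sum_depart_le x i).trans hn.le))
    simp only [Pi.one_apply]
    linarith
  · rw [Set.indicator_of_notMem (show x ∉ totalLE k n from not_le.2 hn),
      Set.indicator_of_notMem (show x ∉ total k n from hn.ne')]
    by_cases hx : x ∈ total k (n + 1) ∩ busy k
    · rw [Set.indicator_of_mem hx]
      have := add_le_stepMean h (x := x) (f := (totalLE k n).indicator 1) (a := 0) (b := 1)
        (fun i _ => hzero _)
        (fun i => hin _ (by
          have := sum_depart x i (hx.2 i); have := mem_total.1 hx.1; omega))
      simp only [Pi.one_apply]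
      linarith
    · rw [Set.indicator_of_notMem hx]
      have := le_stepMean_of_le h (x := x) (fun _ _ => hzero _) (fun _ => hzero _)
      linarith

/-! ### Stationary laws: balance inequalities, mass at the empty state, uniqueness. -/

namespace IsStationary

variable {π : Measure (Fin k → ℕ)}

lemma trafficIntensity_mul_total_le (h : PosParams lam mu) (hπ : IsStationary lam mu π) (n : ℕ) :
    trafficIntensity lam mu * π.real (total k n) ≤ π.real (total k (n + 1)) := by
  have := hπ.1
  have hΛ := h.totalRate_pos
  have hb := abs_indicator_one_le (totalLE k n)
  have h3 := (hπ.integral_drift h hb).symm.trans_le (integral_mono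
    ((integrable_of_bdd (abs_stepMean_le h hb)).sub (integrable_of_bdd hb))
    (((integrable_indicator_real _).const_mul _).sub ((integrable_indicator_real _).const_mul _))
    (stepMean_totalLE_le h n))
  simp only [Pi.sub_apply] at h3
  rw [integral_sub ((integrable_indicator_real _).const_mul _)
    ((integrable_indicator_real _).const_mul _), integral_const_mul, integral_const_mul,
    integral_indicator_real, integral_indicator_real, div_mul_eq_mul_div, div_mul_eq_mul_div,
    ← sub_div] at h3
  have h4 := (le_div_iff₀ hΛ).1 h3
  rw [trafficIntensity, div_mul_eq_mul_div, div_le_iff₀ h.sum_pos]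
  linarith

lemma total_inter_busy_le (h : PosParams lam mu) (hπ : IsStationary lam mu π) (n : ℕ) :
    π.real (total k (n + 1) ∩ busy k) ≤ trafficIntensity lam mu * π.real (total k n) := by
  have := hπ.1
  have hΛ := h.totalRate_pos
  have hb := abs_indicator_one_le (totalLE k n)
  have h3 := (integral_mono
    (((integrable_indicator_real _).const_mul _).sub ((integrable_indicator_real _).const_mul _))
    ((integrable_of_bdd (abs_stepMean_le h hb)).sub (integrable_of_bdd hb))
    (le_stepMean_totalLE h n)).trans_eq (hπ.integral_drift h hb)
  simp only [Pi.sub_apply] at h3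
  rw [integral_sub ((integrable_indicator_real _).const_mul _)
    ((integrable_indicator_real _).const_mul _), integral_const_mul, integral_const_mul,
    integral_indicator_real, integral_indicator_real, div_mul_eq_mul_div, div_mul_eq_mul_div,
    ← sub_div] at h3
  have h4 := (div_le_iff₀ hΛ).1 h3
  rw [trafficIntensity, div_mul_eq_mul_div, le_div_iff₀ h.sum_pos]
  linarith

/-- If some server is idle, the customers are spread over at most `k - 1` queues. -/
lemma total_succ_le (h : PosParams lam mu) (hπ : IsStationary lam mu π) {n j : ℕ}
    (hj : (k - 1) * j ≤ n) :
    π.real (total k (n + 1))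
      ≤ trafficIntensity lam mu * π.real (total k n) + π.real (longer k j) := by
  have := hπ.1
  have hsub : total k (n + 1) ⊆ (total k (n + 1) ∩ busy k) ∪ longer k j := by
    intro x hx
    by_cases hb : x ∈ busy k
    · exact Or.inl ⟨hx, hb⟩
    refine Or.inr ?_
    by_contra hl
    obtain ⟨i, hi⟩ : ∃ i, ¬ 0 < x i := not_forall.1 hb
    have hle : ∀ l, x l ≤ j := fun l => not_lt.1 fun hlt => hl ⟨l, hlt⟩
    have h1 : ∑ l ∈ Finset.univ.erase i, x l ≤ (Finset.univ.erase i).card • j :=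
      Finset.sum_le_card_nsmul _ _ _ fun l _ => hle l
    rw [Finset.card_erase_of_mem (Finset.mem_univ i), Finset.card_univ, Fintype.card_fin,
      smul_eq_mul] at h1
    have h2 := Finset.add_sum_erase _ x (Finset.mem_univ i)
    have h3 := mem_total.1 hx
    omega
  exact (measureReal_mono hsub).trans ((measureReal_union_le _ _).trans
    (add_le_add_left (hπ.total_inter_busy_le h n) _))

/-- The set of atoms is nonempty and closed under service completions, each of which has positive
probability. -/
lemma real_singleton_zero_pos (h : PosParams lam mu) (hπ : IsStationary lam mu π) :
    0 < π.real {0} := by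
  have := hπ.1
  refine zero_mem_of_depart_mem (A := {x | 0 < π.real {x}}) (fun x hx i => ?_) ?_
  · have hb := abs_indicator_one_le ({depart x i} : Set (Fin k → ℕ))
    have h1 := hπ.integral_drift h hb
    rw [integral_sub (integrable_of_bdd (abs_stepMean_le h hb)) (integrable_of_bdd hb),
      integral_indicator_real, sub_eq_zero] at h1
    have hle : ∀ y, mu i / totalRate lam mu * ({x} : Set (Fin k → ℕ)).indicator 1 y
        ≤ stepMean lam mu (({depart x i} : Set (Fin k → ℕ)).indicator 1) y := by
      intro y
      have h0 : ∀ z, 0 ≤ ({depart x i} : Set (Fin k → ℕ)).indicator (1 : (Fin k → ℕ) → ℝ) z :=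
        fun z => Set.indicator_nonneg (fun _ _ => zero_le_one) z
      by_cases hy : y = x
      · subst hy
        refine le_of_eq_of_le ?_ (le_stepMean_depart h h0 y i)
        simp
      · rw [Set.indicator_of_notMem (by exact hy), mul_zero]
        exact le_stepMean_of_le h (fun _ _ => h0 _) (fun _ => h0 _)
    have h2 := integral_mono ((integrable_indicator_real (π := π) _).const_mul _)
      (integrable_of_bdd (abs_stepMean_le h hb)) hle
    rw [integral_const_mul, integral_indicator_real, h1] at h2
    exact (mul_pos (h.serviceProb_pos i) hx).trans_le h2
  · by_contra hcon
    have h0 : π = 0 := Measure.ext_of_singleton fun x => by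
      have : ¬ 0 < π.real {x} := fun hx => hcon ⟨x, hx⟩
      simpa using (measureReal_eq_zero_iff (measure_ne_top _ _)).1 (le_antisymm (not_lt.1 this) measureReal_nonneg)
    exact IsProbabilityMeasure.ne_zero π h0

lemma pow_mul_le_total (h : PosParams lam mu) (hπ : IsStationary lam mu π) (n : ℕ) :
    trafficIntensity lam mu ^ n * π.real {0} ≤ π.real (total k n) := by
  have := hπ.1
  induction n with
  | zero =>
    rw [pow_zero, one_mul]
    exact measureReal_mono (Set.singleton_subset_iff.2 (mem_total.2 (by simp)))
  | succ n ih =>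
    refine le_trans ?_ (hπ.trafficIntensity_mul_total_le h n)
    rw [pow_succ', mul_assoc]
    exact mul_le_mul_of_nonneg_left ih h.trafficIntensity_pos.le

lemma hasSum_integral {f : (Fin k → ℕ) → ℝ} (hf : Integrable f π) :
    HasSum (fun x => π.real {x} * f x) (∫ x, f x ∂π) := by
  have hf' := hf
  rw [← Measure.sum_smul_dirac π] at hf'
  have := hasSum_integral_measure hf'
  rw [Measure.sum_smul_dirac] at this
  simpa [integral_smul_measure, measureReal_def] using this

/-- Let `A` be the set where `π` has the larger atom. The drift of the indicator of `Aᶜ` integrates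
to zero against both laws, yet each term of the difference is nonnegative; so no step leaves `A`. If
nonempty, `A` would then contain the empty state, against `h0`. -/
lemma le_of_singleton_zero_le (h : PosParams lam mu) (hπ : IsStationary lam mu π)
    {π' : Measure (Fin k → ℕ)} (hπ' : IsStationary lam mu π') (h0 : π.real {0} ≤ π'.real {0}) :
    π ≤ π' := by
  have := hπ.1
  have := hπ'.1
  set A : Set (Fin k → ℕ) := {x | π'.real {x} < π.real {x}} with hA
  have hempty : A = ∅ := by
    by_contra hne
    refine not_lt.2 h0 (zero_mem_of_depart_mem (A := A) (fun x hx i => ?_)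
      (Set.nonempty_iff_ne_empty.2 hne))
    have hb := abs_indicator_one_le Aᶜ
    have hnn : ∀ y, 0 ≤ Aᶜ.indicator (1 : (Fin k → ℕ) → ℝ) y :=
      fun y => Set.indicator_nonneg (fun _ _ => zero_le_one) y
    have hone : ∀ y, Aᶜ.indicator (1 : (Fin k → ℕ) → ℝ) y ≤ 1 := fun y => (abs_le.1 (hb y)).2
    have hint : ∀ ν : Measure (Fin k → ℕ), IsFiniteMeasure ν → Integrable
        (fun y => stepMean lam mu (Aᶜ.indicator 1) y - Aᶜ.indicator 1 y) ν := fun ν _ =>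
      (integrable_of_bdd (abs_stepMean_le h hb)).sub (integrable_of_bdd hb)
    have hs := (hasSum_integral (hint π inferInstance)).sub (hasSum_integral (hint π' inferInstance))
    rw [hπ.integral_drift h hb, hπ'.integral_drift h hb, sub_zero] at hs
    have hterm : ∀ y, 0 ≤ π.real {y} * (stepMean lam mu (Aᶜ.indicator 1) y - Aᶜ.indicator 1 y)
        - π'.real {y} * (stepMean lam mu (Aᶜ.indicator 1) y - Aᶜ.indicator 1 y) := by
      intro y
      rw [← sub_mul]
      by_cases hy : y ∈ A
      · rw [Set.indicator_of_notMem (show y ∉ Aᶜ from fun hn => hn hy), sub_zero]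
        exact mul_nonneg (sub_nonneg.2 (le_of_lt hy))
          (le_stepMean_of_le h (fun _ _ => hnn _) (fun _ => hnn _))
      · rw [Set.indicator_of_mem (show y ∈ Aᶜ from hy)]
        exact mul_nonneg_of_nonpos_of_nonpos (sub_nonpos.2 (not_lt.1 hy))
          (sub_nonpos.2 (stepMean_le_of_le h (fun _ _ => hone _) (fun _ => hone _)))
    have hx0 := congrFun ((hasSum_zero_iff_of_nonneg hterm).1 hs) x
    simp only [Pi.zero_apply] at hx0
    rw [← sub_mul, Set.indicator_of_notMem (show x ∉ Aᶜ from fun hn => hn hx), sub_zero] at hx0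
    have hz := (mul_eq_zero.1 hx0).resolve_left (sub_pos.2 hx).ne'
    by_contra hd
    have := le_stepMean_depart h hnn x i
    rw [hz, Set.indicator_of_mem (show depart x i ∈ Aᶜ from hd), Pi.one_apply, mul_one] at this
    exact this.not_gt (h.serviceProb_pos i)
  have hpt : ∀ x, π {x} ≤ π' {x} := fun x => by
    have : x ∉ A := hempty ▸ Set.notMem_empty x
    exact (ENNReal.toReal_le_toReal (measure_ne_top _ _) (measure_ne_top _ _)).1 (not_lt.1 this)
  refine Measure.le_iff.2 fun s _ => ?_
  rw [← lintegral_indicator_one (.of_discrete), ← lintegral_indicator_one (μ := π') (.of_discrete),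
    lintegral_countable', lintegral_countable']
  exact ENNReal.tsum_le_tsum fun x => mul_le_mul_right (hpt x) _

theorem eq (h : PosParams lam mu) (hπ : IsStationary lam mu π) {π' : Measure (Fin k → ℕ)}
    (hπ' : IsStationary lam mu π') : π = π' := by
  have := hπ.1
  have := hπ'.1
  rcases le_total (π.real {0}) (π'.real {0}) with h0 | h0
  · exact Measure.eq_of_le_of_isProbabilityMeasure (hπ.le_of_singleton_zero_le h hπ' h0)
  · exact (Measure.eq_of_le_of_isProbabilityMeasure (hπ'.le_of_singleton_zero_le h hπ h0)).symm

end IsStationary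

/-! ### Existence: limits of Cesàro averages from the empty state. -/

/-- The one-step mean as a linear operator on functions. -/
noncomputable def stepOp (lam : ℝ) (mu : Fin k → ℝ) : Module.End ℝ ((Fin k → ℕ) → ℝ) where
  toFun := stepMean lam mu
  map_add' f g := funext fun x => stepMean_add f g x
  map_smul' c f := funext fun x => stepMean_const_mul c f x

/-- The mean of `f` after `j` steps of the chain started from the empty state. -/
noncomputable def meanFromZero (lam : ℝ) (mu : Fin k → ℝ) (j : ℕ) :
    ((Fin k → ℕ) → ℝ) →ₗ[ℝ] ℝ :=
  LinearMap.proj 0 ∘ₗ (stepOp lam mu) ^ j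

lemma meanFromZero_zero (f : (Fin k → ℕ) → ℝ) : meanFromZero lam mu 0 f = f 0 := by
  simp [meanFromZero]

lemma meanFromZero_succ (j : ℕ) (f : (Fin k → ℕ) → ℝ) :
    meanFromZero lam mu (j + 1) f = meanFromZero lam mu j (stepMean lam mu f) := by
  simp only [meanFromZero, pow_succ]
  rfl

lemma meanFromZero_mono (h : PosParams lam mu) (j : ℕ) {f g : (Fin k → ℕ) → ℝ} (hfg : f ≤ g) :
    meanFromZero lam mu j f ≤ meanFromZero lam mu j g := by
  induction j generalizing f g with
  | zero => rw [meanFromZero_zero, meanFromZero_zero]; exact hfg 0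
  | succ j ih =>
    rw [meanFromZero_succ, meanFromZero_succ]
    exact ih (stepMean_mono h hfg)

lemma meanFromZero_one (h : PosParams lam mu) (j : ℕ) : meanFromZero lam mu j 1 = 1 := by
  induction j with
  | zero => rw [meanFromZero_zero, Pi.one_apply]
  | succ j ih =>
    rw [meanFromZero_succ, show stepMean lam mu 1 = 1 from funext fun x => stepMean_const h 1 x, ih]

lemma meanFromZero_indicator_mem_Icc (h : PosParams lam mu) (j : ℕ) (A : Set (Fin k → ℕ)) :
    meanFromZero lam mu j (A.indicator 1) ∈ Set.Icc (0 : ℝ) 1 := by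
  constructor
  · rw [← map_zero (meanFromZero lam mu j)]
    exact meanFromZero_mono h j (Set.indicator_nonneg fun _ _ => zero_le_one)
  · rw [← meanFromZero_one h j]
    exact meanFromZero_mono h j fun x => (abs_le.1 (abs_indicator_one_le A x)).2

/-- The average of the laws of the first `n + 1` steps of the chain started from the empty
state. -/
noncomputable def cesaro (lam : ℝ) (mu : Fin k → ℝ) (n : ℕ) : ((Fin k → ℕ) → ℝ) →ₗ[ℝ] ℝ :=
  ((n : ℝ) + 1)⁻¹ • ∑ j ∈ Finset.range (n + 1), meanFromZero lam mu j

lemma cesaro_apply (n : ℕ) (f : (Fin k → ℕ) → ℝ) :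
    cesaro lam mu n f
      = ((n : ℝ) + 1)⁻¹ * ∑ j ∈ Finset.range (n + 1), meanFromZero lam mu j f := by
  simp [cesaro]

lemma cesaro_indicator_mem_Icc (h : PosParams lam mu) (n : ℕ) (A : Set (Fin k → ℕ)) :
    cesaro lam mu n (A.indicator 1) ∈ Set.Icc (0 : ℝ) 1 := by
  rw [cesaro_apply]
  have hn : (0 : ℝ) < (n : ℝ) + 1 := by positivity
  refine ⟨mul_nonneg (inv_nonneg.2 hn.le) (Finset.sum_nonneg fun j _ =>
    (meanFromZero_indicator_mem_Icc h j A).1), ?_⟩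
  rw [inv_mul_le_iff₀ hn, mul_one]
  refine (Finset.sum_le_card_nsmul _ _ 1 fun j _ =>
    (meanFromZero_indicator_mem_Icc h j A).2).trans_eq (by simp)

lemma cesaro_stepMean_sub (n : ℕ) (f : (Fin k → ℕ) → ℝ) :
    cesaro lam mu n (stepMean lam mu f) - cesaro lam mu n f
      = ((n : ℝ) + 1)⁻¹ * (meanFromZero lam mu (n + 1) f - meanFromZero lam mu 0 f) := by
  rw [cesaro_apply, cesaro_apply, ← mul_sub, ← Finset.sum_sub_distrib,
    ← Finset.sum_range_sub (fun j => meanFromZero lam mu j f)]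
  simp only [meanFromZero_succ]

lemma exists_half_le_cesaro (h : PosParams lam mu) (hstab : trafficIntensity lam mu < 1) :
    ∃ F : Finset (Fin k → ℕ), ∀ n,
      1 / 2 ≤ cesaro lam mu n ((F : Set (Fin k → ℕ)).indicator 1) := by
  obtain ⟨d, hd⟩ := exists_drift_le h hstab
  refine ⟨Finset.Iic fun _ => d, fun n => ?_⟩
  set F : Set (Fin k → ℕ) := ((Finset.Iic fun _ => d : Finset (Fin k → ℕ)) : Set (Fin k → ℕ))
    with hF
  -- The drift is at most `-1` off the box and at most `+1` on it, hence the factor `2`. Averaging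
  -- telescopes, and `excess 0` starts at zero and stays nonnegative.
  have hdrift : (1 : (Fin k → ℕ) → ℝ) + stepMean lam mu (excess 0)
      ≤ excess 0 + (2 : ℝ) • F.indicator 1 := by
    intro x
    simp only [Pi.add_apply, Pi.one_apply, Pi.smul_apply, smul_eq_mul]
    by_cases hx : x ∈ F
    · rw [Set.indicator_of_mem hx, Pi.one_apply]
      have h1 := stepMean_excess_le h 0 x
      have h2 : 0 ≤ ∑ i, mu i / totalRate lam mu * ((x i - 0 : ℕ) : ℝ) :=
        Finset.sum_nonneg fun i _ => mul_nonneg (h.serviceProb_pos i).le (Nat.cast_nonneg _)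
      have h3 := mul_nonneg (by linarith : 0 ≤ 2 * (1 - trafficIntensity lam mu)) h2
      linarith
    · rw [Set.indicator_of_notMem hx]
      have : ∃ j, 0 + d < x j := by
        by_contra! hcon
        exact hx (Finset.mem_coe.2 (Finset.mem_Iic.2 fun j => by simpa using hcon j))
      have := hd 0 x this
      linarith
  have hmono : ∀ {f g : (Fin k → ℕ) → ℝ}, f ≤ g → cesaro lam mu n f ≤ cesaro lam mu n g := by
    intro f g hfg
    rw [cesaro_apply, cesaro_apply]
    exact mul_le_mul_of_nonneg_left
      (Finset.sum_le_sum fun j _ => meanFromZero_mono h j hfg) (by positivity)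
  have h1 := hmono hdrift
  rw [map_add, map_add, map_smul, smul_eq_mul] at h1
  have h2 := cesaro_stepMean_sub (lam := lam) (mu := mu) n (excess 0)
  have h3 : 0 ≤ meanFromZero lam mu (n + 1) (excess 0) := by
    rw [← map_zero (meanFromZero lam mu (n + 1))]
    exact meanFromZero_mono h _ (excess_nonneg 0)
  have h4 : meanFromZero lam mu 0 (excess 0) = 0 := by
    rw [meanFromZero_zero]; simp [excess]
  have h5 : cesaro lam mu n 1 = 1 := by
    rw [cesaro_apply]
    simp only [meanFromZero_one h, Finset.sum_const, Finset.card_range, nsmul_eq_mul, mul_one]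
    push_cast
    exact inv_mul_cancel₀ (by positivity)
  rw [h4, sub_zero] at h2
  have h6 : 0 ≤ ((n : ℝ) + 1)⁻¹ * meanFromZero lam mu (n + 1) (excess 0) := by positivity
  linarith

lemma le_depart_add_one (x : Fin k → ℕ) (i j : Fin k) : x j ≤ depart x i j + 1 := by
  unfold depart
  rcases eq_or_ne j i with rfl | hne
  · rw [Function.update_self]; omega
  · rw [Function.update_of_ne hne]; omega

lemma le_arrive (x : Fin k → ℕ) (i j : Fin k) : x j ≤ arrive x i j := by
  unfold arrive
  rcases eq_or_ne j i with rfl | hne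
  · rw [Function.update_self]; omega
  · rw [Function.update_of_ne hne]

/-- Each state has finitely many predecessors, so its balance equation is a finite sum and survives
pointwise limits. -/
lemma stepMean_singleton_eq_zero (y x : Fin k → ℕ) (hx : x ∉ Finset.Iic (y + 1)) :
    stepMean lam mu (({y} : Set (Fin k → ℕ)).indicator 1) x = 0 := by
  obtain ⟨j, hj⟩ : ∃ j, ¬ x j ≤ (y + 1) j := by
    by_contra! hcon
    exact hx (Finset.mem_Iic.2 hcon)
  have hj' : y j + 1 < x j := not_le.1 hj
  unfold stepMean
  rw [Finset.sum_eq_zero, Finset.sum_eq_zero, add_zero]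
  · intro i _
    rw [Set.indicator_of_notMem, mul_zero]
    intro hy
    have h1 := congrFun (Set.mem_singleton_iff.1 hy) j
    have := le_depart_add_one x i j
    omega
  · intro i _
    rw [Set.indicator_of_notMem, mul_zero]
    intro hy
    have h1 := congrFun (Set.mem_singleton_iff.1 hy) j
    have := le_arrive x i j
    omega

lemma eq_sum_indicator {f : (Fin k → ℕ) → ℝ} {G : Finset (Fin k → ℕ)} (hf : ∀ x ∉ G, f x = 0) :
    f = ∑ x ∈ G, f x • ({x} : Set (Fin k → ℕ)).indicator (1 : (Fin k → ℕ) → ℝ) := by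
  classical
  funext z
  rw [Finset.sum_apply]
  simp only [Pi.smul_apply, smul_eq_mul, Set.indicator_apply, Set.mem_singleton_iff, Pi.one_apply,
    mul_ite, mul_one, mul_zero]
  rw [Finset.sum_ite_eq]
  split_ifs with hz
  · rfl
  · exact hf z hz

lemma indicator_finset_eq_sum (G : Finset (Fin k → ℕ)) :
    (G : Set (Fin k → ℕ)).indicator (1 : (Fin k → ℕ) → ℝ)
      = ∑ x ∈ G, ({x} : Set (Fin k → ℕ)).indicator (1 : (Fin k → ℕ) → ℝ) := by
  refine (eq_sum_indicator (G := G) fun x hx => Set.indicator_of_notMem (by simpa using hx) _).trans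
    (Finset.sum_congr rfl fun x hx => ?_)
  rw [Set.indicator_of_mem (by simpa using hx), Pi.one_apply, one_smul]

/-- A nonzero summable solution of the balance equations. -/
lemma exists_balanced (h : PosParams lam mu) (hstab : trafficIntensity lam mu < 1) :
    ∃ p : (Fin k → ℕ) → ℝ, (∀ x, 0 ≤ p x) ∧ (∃ x, p x ≠ 0) ∧ Summable p ∧
      ∀ y, p y = ∑ x ∈ Finset.Iic (y + 1),
        stepMean lam mu (({y} : Set (Fin k → ℕ)).indicator 1) x * p x := by
  -- A single ultrafilter gives limits at all states at once, with no diagonal subsequence.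
  have hlim : ∀ x : Fin k → ℕ, ∃ l ∈ Set.Icc (0 : ℝ) 1,
      Tendsto (fun n => cesaro lam mu n (({x} : Set (Fin k → ℕ)).indicator 1))
        (hyperfilter ℕ : Filter ℕ) (𝓝 l) := fun x =>
    isCompact_Icc.ultrafilter_le_nhds'
      ((hyperfilter ℕ).map fun n => cesaro lam mu n (({x} : Set (Fin k → ℕ)).indicator 1))
      (Ultrafilter.mem_map.2 (univ_mem' fun n => cesaro_indicator_mem_Icc h n {x}))
  choose p hp hpl using hlim
  have hsum : ∀ G : Finset (Fin k → ℕ), Tendsto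
      (fun n => cesaro lam mu n ((G : Set (Fin k → ℕ)).indicator 1))
      (hyperfilter ℕ : Filter ℕ) (𝓝 (∑ x ∈ G, p x)) := fun G => by
    simp only [indicator_finset_eq_sum, map_sum]
    exact tendsto_finsetSum _ fun x _ => hpl x
  refine ⟨p, fun x => (hp x).1, ?_, ?_, fun y => ?_⟩
  -- Mass may escape in the limit, but at least half stays in `F`; normalization repairs the rest
  -- later.
  · obtain ⟨F, hF⟩ := exists_half_le_cesaro h hstab
    have h1 := ge_of_tendsto' (hsum F) hF
    by_contra! hcon
    rw [Finset.sum_eq_zero fun x _ => hcon x] at h1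
    norm_num at h1
  · exact summable_of_sum_le (fun x => (hp x).1) fun G =>
      le_of_tendsto' (hsum G) fun n => (cesaro_indicator_mem_Icc h n _).2
  · set f := ({y} : Set (Fin k → ℕ)).indicator (1 : (Fin k → ℕ) → ℝ) with hf
    have h1 : Tendsto (fun n => cesaro lam mu n (stepMean lam mu f)) (hyperfilter ℕ : Filter ℕ)
        (𝓝 (∑ x ∈ Finset.Iic (y + 1), stepMean lam mu f x * p x)) := by
      have heq : ∀ n, cesaro lam mu n (stepMean lam mu f) = ∑ x ∈ Finset.Iic (y + 1),
          stepMean lam mu f x * cesaro lam mu n (({x} : Set (Fin k → ℕ)).indicator 1) := fun n => by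
        conv_lhs => rw [eq_sum_indicator (stepMean_singleton_eq_zero (lam := lam) (mu := mu) y)]
        rw [map_sum]
        exact Finset.sum_congr rfl fun x _ => by rw [map_smul, smul_eq_mul]
      simp only [heq]
      exact tendsto_finsetSum _ fun x _ => (hpl x).const_mul _
    have h2 : Tendsto (fun n => cesaro lam mu n (stepMean lam mu f) - cesaro lam mu n f)
        (hyperfilter ℕ : Filter ℕ) (𝓝 0) := by
      have hz : Tendsto (fun n : ℕ => ((n : ℝ) + 1)⁻¹) (hyperfilter ℕ : Filter ℕ) (𝓝 0) := by
        have := tendsto_one_div_add_atTop_nhds_zero_nat (𝕜 := ℝ)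
        simp only [one_div] at this
        exact this.mono_left (Nat.hyperfilter_le_atTop)
      refine squeeze_zero_norm (fun n => ?_) hz
      rw [cesaro_stepMean_sub, Real.norm_eq_abs, abs_mul, abs_of_nonneg (by positivity)]
      refine mul_le_of_le_one_right (by positivity) (abs_le.2 ?_)
      have ha := meanFromZero_indicator_mem_Icc h (n + 1) {y}
      have hb := meanFromZero_indicator_mem_Icc h 0 {y}
      exact ⟨by linarith [ha.1, hb.2], by linarith [ha.2, hb.1]⟩
    exact (sub_eq_zero.1 (tendsto_nhds_unique (h1.sub (hpl y)) h2)).symm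

theorem exists_isStationary (h : PosParams lam mu) (hstab : trafficIntensity lam mu < 1) :
    ∃ π, IsStationary lam mu π := by
  obtain ⟨p, hp0, ⟨x₀, hx₀⟩, hps, hbal⟩ := exists_balanced h hstab
  have hf0 : (∑' x, ENNReal.ofReal (p x)) ≠ 0 := fun hz =>
    hx₀ (le_antisymm (ENNReal.ofReal_eq_zero.1 (ENNReal.tsum_eq_zero.1 hz x₀)) (hp0 x₀))
  set π := (PMF.normalize (fun x => ENNReal.ofReal (p x)) hf0 hps.tsum_ofReal_ne_top).toMeasure
    with hπ
  set Z := (∑' x, ENNReal.ofReal (p x))⁻¹.toReal with hZ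
  have hreal : ∀ x, π.real {x} = p x * Z := fun x => by
    rw [measureReal_def, hπ, PMF.toMeasure_apply_singleton _ _ (.of_discrete), PMF.normalize_apply,
      ENNReal.toReal_mul, ENNReal.toReal_ofReal (hp0 x)]
  have hprob : IsProbabilityMeasure π := PMF.toMeasure.isProbabilityMeasure _
  have := isMarkovKernel_chain h
  refine ⟨π, hprob, Measure.ext_of_singleton fun y => ?_⟩
  refine (measureReal_eq_measureReal_iff (measure_ne_top _ _) (measure_ne_top _ _)).1 ?_
  have hb := abs_indicator_one_le ({y} : Set (Fin k → ℕ))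
  rw [← integral_indicator_real, integral_bind_chain h π hb, hreal,
    ← (IsStationary.hasSum_integral (integrable_of_bdd (abs_stepMean_le h hb))).tsum_eq,
    tsum_eq_sum (s := Finset.Iic (y + 1)) (fun x hx => by
      rw [stepMean_singleton_eq_zero y x hx, mul_zero]), hbal y, Finset.sum_mul]
  exact Finset.sum_congr rfl fun x _ => by rw [hreal]; ring

/-! ### The decay rate. -/

lemma total_subset_longer {n m : ℕ} (hnm : k * m < n) : total k n ⊆ longer k m := by
  intro x hx
  by_contra hl
  have hle : ∀ l, x l ≤ m := fun l => not_lt.1 fun hlt => hl ⟨l, hlt⟩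
  have h1 : ∑ l, x l ≤ (Finset.univ : Finset (Fin k)).card • m :=
    Finset.sum_le_card_nsmul _ _ _ fun l _ => hle l
  rw [Finset.card_univ, Fintype.card_fin, smul_eq_mul, mem_total.1 hx] at h1
  omega

lemma const_mem_total (m : ℕ) : (fun _ => m) ∈ total k (k * m) := by
  rw [mem_total]; simp

namespace IsStationary

variable {π : Measure (Fin k → ℕ)}

lemma real_const_le_total (hπ : IsStationary lam mu π) (m : ℕ) :
    π.real {fun _ => m} ≤ π.real (total k (k * m)) := by
  have := hπ.1
  exact measureReal_mono (Set.singleton_subset_iff.2 (const_mem_total m))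

lemma longer_succ_add_le (h : PosParams lam mu) (hπ : IsStationary lam mu π) (m : ℕ) :
    π.real (longer k (m + 1)) + π.real {fun _ => m + 1} ≤ π.real (longer k m) := by
  have := hπ.1
  obtain ⟨i⟩ := h.nonempty
  have hnot : (fun _ => m + 1) ∉ longer k (m + 1) := fun ⟨_, hj⟩ => lt_irrefl _ hj
  rw [← measureReal_union (Set.disjoint_singleton_right.2 hnot) (.of_discrete)]
  refine measureReal_mono (Set.union_subset (fun x ⟨j, hj⟩ => ⟨j, by omega⟩)
    (Set.singleton_subset_iff.2 ⟨i, Nat.lt_succ_self m⟩))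

/-- The balanced state at `m + 1` lies in `longer k m` but not in `longer k (m + 1)`. So `hlong`
bounds the tail by `C` times its own decrement, which forces contraction by `C / (1 + C)`. A `k`-th
root passes from queue length to number of customers. -/
lemma exists_total_le_geometric (h : PosParams lam mu) (hπ : IsStationary lam mu π) {d : ℕ} {C : ℝ}
    (hC : 0 < C) (hlong : ∀ m, d ≤ m → π.real (longer k m) ≤ C * π.real {fun _ => m}) :
    ∃ A r : ℝ, 0 ≤ A ∧ 0 < r ∧ r < 1 ∧ ∀ n, π.real (total k n) ≤ A * r ^ n := by
  have := hπ.1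
  have hk : (k : ℝ) ≠ 0 := by have := h.two_le; exact_mod_cast (by omega : k ≠ 0)
  set q := C / (1 + C) with hq
  have hq0 : 0 < q := by positivity
  have hq1 : q < 1 := by rw [hq, div_lt_one (by positivity)]; linarith
  have hgeo : ∀ i, π.real (longer k (d + i)) ≤ q ^ i := by
    intro i
    induction i with
    | zero => simp
    | succ i ih =>
      have h1 := hπ.longer_succ_add_le h (d + i)
      have h2 := hlong (d + i + 1) (by omega)
      have h3 : π.real (longer k (d + i + 1)) ≤ q * π.real (longer k (d + i)) := by
        rw [hq, div_mul_eq_mul_div, le_div_iff₀ (by positivity)]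
        nlinarith
      exact h3.trans (by rw [pow_succ']; gcongr)
  set r := q ^ ((k : ℝ)⁻¹) with hr
  have hr0 : 0 < r := by positivity
  have hr1 : r < 1 := Real.rpow_lt_one hq0.le hq1 (by positivity)
  have hrk : r ^ k = q := by
    rw [hr, ← Real.rpow_natCast, ← Real.rpow_mul hq0.le, inv_mul_cancel₀ hk, Real.rpow_one]
  refine ⟨(r ^ (k * (d + 1)))⁻¹, r, by positivity, hr0, hr1, fun n => ?_⟩
  -- `n - 1` because the total must strictly exceed `k * m`. For small `n` the subtraction truncates
  -- to `0` and the bound is the trivial one.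
  set i := (n - 1) / k - d with hi
  have hk0 : 0 < k := by have := h.two_le; omega
  have hlt := Nat.lt_mul_div_succ (n - 1) hk0
  have hle := Nat.mul_div_le (n - 1) k
  have hn : n ≤ k * i + k * (d + 1) := by
    have : k * ((n - 1) / k + 1) ≤ k * (i + (d + 1)) := Nat.mul_le_mul_left _ (by omega)
    rw [← mul_add]; omega
  have hs : π.real (total k n) ≤ q ^ i := by
    rcases Nat.eq_zero_or_pos i with h0 | h0
    · rw [h0, pow_zero]; exact measureReal_le_one
    · have hid : d + i = (n - 1) / k := by omega
      refine (measureReal_mono (total_subset_longer ?_)).trans (hgeo i)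
      rw [hid]
      have : n ≠ 0 := by rintro rfl; simp at hi; omega
      omega
  rw [← hrk, ← pow_mul] at hs
  rw [inv_mul_eq_div, le_div_iff₀ (by positivity)]
  calc π.real (total k n) * r ^ (k * (d + 1)) ≤ r ^ (k * i) * r ^ (k * (d + 1)) := by gcongr
    _ = r ^ (k * i + k * (d + 1)) := (pow_add _ _ _).symm
    _ ≤ r ^ n := pow_le_pow_of_le_one hr0.le hr1.le hn

theorem tendsto_log_minQueue (h : PosParams lam mu) (hstab : trafficIntensity lam mu < 1)
    (hπ : IsStationary lam mu π) :
    Tendsto (fun n : ℕ => (1 / (n : ℝ)) * Real.log (π.real {x | minQueue x = n})) atTop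
      (𝓝 (Real.log (trafficIntensity lam mu ^ k))) := by
  have := hπ.1
  have := h.nonempty
  obtain ⟨d, C, hC, hlong⟩ := exists_longer_le h hstab
  replace hlong := hlong π hπ
  set ρ := trafficIntensity lam mu with hρdef
  have hρ : 0 < ρ := h.trafficIntensity_pos
  obtain ⟨A, r, hA, hr0, hr1, hs⟩ := hπ.exists_total_le_geometric h hC hlong
  obtain ⟨K, hK⟩ := exists_le_mul_pow_of_bootstrap (d := d) (C := C)
    (s := fun n => π.real (total k n)) h.two_le hρ hstab
    hC.le (fun _ => measureReal_nonneg) (fun _ => measureReal_le_one)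
    (fun n j hj hdj => (hπ.total_succ_le h hj).trans (add_le_add_right ((hlong j hdj).trans
      (mul_le_mul_of_nonneg_left (hπ.real_const_le_total j) hC.le)) _)) hA hr0 hr1 hs
  have h0 := hπ.real_singleton_zero_pos h
  -- The factor `ρ` in `c₁` comes from the extra customer in `k * n + 1`, and `ρ ^ k` in `c₂` from
  -- the shift from `n` to `n - 1`.
  refine tendsto_log_div_of_geometric_bounds (c₁ := ρ * π.real {0} / C) (c₂ := C * K / ρ ^ k)
    (pow_pos hρ k) (by positivity) ?_ ?_
  · filter_upwards [eventually_ge_atTop d] with n hn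
    have h1 := hπ.pow_mul_le_total h (k * n + 1)
    have h2 : π.real (total k (k * n + 1)) ≤ π.real (longer k n) :=
      measureReal_mono (total_subset_longer (Nat.lt_succ_self _))
    have h3 : π.real {fun _ => n} ≤ π.real {x : Fin k → ℕ | minQueue x = n} :=
      measureReal_mono (Set.singleton_subset_iff.2 (by
        change minQueue (fun _ : Fin k => n) = n
        exact ciInf_const))
    refine le_trans ?_ h3
    rw [div_mul_eq_mul_div, div_le_iff₀ hC, ← pow_mul]
    have h4 := h1.trans (h2.trans (hlong n hn))
    rw [pow_succ] at h4
    linarith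
  · filter_upwards [eventually_ge_atTop (d + 1)] with n hn
    obtain ⟨m, rfl⟩ : ∃ m, n = m + 1 := ⟨n - 1, by omega⟩
    have h1 : π.real {x : Fin k → ℕ | minQueue x = m + 1} ≤ π.real (longer k m) :=
      measureReal_mono fun x hx => by
        obtain ⟨i, hi⟩ := exists_eq_minQueue x
        have hx' : minQueue x = m + 1 := hx
        exact ⟨i, by omega⟩
    refine (h1.trans (hlong m (by omega))).trans ?_
    have h2 := mul_le_mul_of_nonneg_left ((hπ.real_const_le_total m).trans (hK (k * m))) hC.le
    refine h2.trans_eq ?_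
    rw [pow_succ, ← pow_mul]
    have := (pow_pos hρ k).ne'
    field_simp

end IsStationary

end JSQ

theorem corollary2p1 (k : ℕ) (hk : 2 ≤ k) (lam : ℝ) (mu : Fin k → ℝ)
    (hlam : 0 < lam) (hmu : ∀ i, 0 < mu i) (hstab : JSQ.trafficIntensity lam mu < 1) :
    (∃! π : Measure (Fin k → ℕ), JSQ.IsStationary lam mu π) ∧
    ∀ π : Measure (Fin k → ℕ), JSQ.IsStationary lam mu π →
      Tendsto (fun n : ℕ => (1 / (n : ℝ)) * Real.log (π.real {x | JSQ.minQueue x = n})) atTop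
        (𝓝 (Real.log (JSQ.trafficIntensity lam mu ^ k))) := by
  have h : JSQ.PosParams lam mu := ⟨hk, hlam, hmu⟩
  obtain ⟨π, hπ⟩ := JSQ.exists_isStationary h hstab
  exact ⟨⟨π, hπ, fun π' hπ' => JSQ.IsStationary.eq h hπ' hπ⟩,
    fun π' hπ' => hπ'.tendsto_log_minQueue h hstab⟩
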